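/- Let $X$ be a non-empty perfect Hausdorff uniform space (perfect: no isolated points) and let $G$ be a subgroup of the group $\mathrm{Aut}(X)$ of bijections of $X$ that are uniformly continuous together with their inverse. Suppose that $G$ is topologically free, i.e. for every finite $E\subseteq G$ the set $\{x\in X \mid \forall g\in E\setminus\{\mathrm{id}_X\}:\ g(x)\neq x\}$ is dense in $X$. A set $\mathcal U$ of subsets of $X$ is a uniform covering if there is an entourage $D$ of $X$ such that for every $x\in X$ the set $\{y \mid (x,y)\in D\}$ is contained in some member of $\mathcal U$; let $\mathcal N(X)$ be the set of all finite uniform coverings of $X$. Write $\mathcal U\preceq\mathcal V$ if every $V\in\mathcal V$ is contained in some $U\in\mathcal U$. For $\mathcal U\in\mathcal N(X)$ let $N(\mathcal U)=\min\{|\mathcal V| \mid \mathcal V\in\mathcal N(X),\ \mathcal U\preceq\mathcal V\}$. For $g\in G$ let $g(\mathcal V)=\{g(V)\mid V\in\mathcal V\}$, and for finite $E\subseteq G$ let $\bigvee_{g\in E}g(\mathcal V)=\{\bigcap_{g\in E}g(V_g)\mid (V_g)_{g\in E}\in\mathcal V^E\}$ (the empty intersection being $X$). The pair $(X,G)$ is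 called amenable if there is a linear map $m:UC_b(X)\to\mathbb R$ on the space of bounded uniformly continuous real-valued functions on $X$ with $\inf_{x\in X} f(x)\le m(f)\le\sup_{x\in X} f(x)$ and $m(f\circ g)=m(f)$ for all $f\in UC_b(X)$ and $g\in G$. Then $(X,G)$ is amenable if and only if $$\sup_{E\subseteq G\ \text{finite}}\ \sup_{\mathcal U\in\mathcal N(X)}\ \inf\left\{\frac{N\left(\bigvee_{g\in E}g(\mathcal V)\right)}{N(\mathcal V)}\ \middle|\ \mathcal V\in\mathcal N(X),\ \mathcal U\preceq\mathcal V\right\}=1 .$$ -/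

import Mathlib

open scoped Uniformity ENNReal

namespace UniformDynamics

section Coverings

/-- `Refines 𝒱 𝒰`: the family `𝒱` refines the family `𝒰`, written `𝒰 ≼ 𝒱`. -/
def Refines {X : Type*} (𝒱 𝒰 : Set (Set X)) : Prop :=
  ∀ V ∈ 𝒱, ∃ U ∈ 𝒰, V ⊆ U

/-- The join `⋁ i, 𝒰 i` of a family of sets of subsets: all intersections `⋂ i, U i` with
`U i ∈ 𝒰 i`. For an empty index type this is `{X}`. -/
def join {X ι : Type*} (𝒰 : ι → Set (Set X)) : Set (Set X) :=
  {S | ∃ U : ι → Set X, (∀ i, U i ∈ 𝒰 i) ∧ S = ⋂ i, U i}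

/-- `𝒰` is a uniform covering of `X`: for some entourage `D`, every ball `D[x]` is contained in a
member of `𝒰`. Since `x ∈ D[x]`, such a family covers `X`; this is the usual
correspondence between uniformities given by entourages and uniformities given by coverings. -/
def IsUniformCovering {X : Type*} [UniformSpace X] (𝒰 : Set (Set X)) : Prop :=
  ∃ D ∈ 𝓤 X, ∀ x : X, ∃ U ∈ 𝒰, UniformSpace.ball x D ⊆ U

/-- The set `𝒩(X)` of all finite uniform coverings of `X`. -/
def finiteUniformCoverings (X : Type*) [UniformSpace X] : Set (Set (Set X)) :=
  {𝒰 | 𝒰.Finite ∧ IsUniformCovering 𝒰}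

/-- The uniform complexity `N(𝒰)`: the least cardinality of a finite uniform covering of `X`
that refines `𝒰` (for `𝒰 ∈ 𝒩(X)`, the set below contains the cardinality of `𝒰`). -/
noncomputable def uniformComplexity {X : Type*} [UniformSpace X] (𝒰 : Set (Set X)) : ℕ :=
  sInf {n | ∃ 𝒱 ∈ finiteUniformCoverings X, Refines 𝒱 𝒰 ∧ 𝒱.ncard = n}

end Coverings

section Automorphisms

/-- The group `Aut(X)` of automorphisms of the uniform space `X`, under composition. -/
instance autGroup (X : Type*) [UniformSpace X] : Group (X ≃ᵤ X) where
  mul g h := h.trans g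
  one := UniformEquiv.refl X
  inv g := g.symm
  mul_assoc _ _ _ := rfl
  one_mul _ := rfl
  mul_one _ := rfl
  inv_mul_cancel g := UniformEquiv.ext g.symm_apply_apply

/-- A subgroup `G` of `Aut(X)` is topologically free if for every finite `E ⊆ G` the set of points
that are fixed by no non-identity element of `E` is dense in `X`. -/
def TopologicallyFree {X : Type*} [UniformSpace X] (G : Subgroup (X ≃ᵤ X)) : Prop :=
  ∀ E : Finset G, Dense {x : X | ∀ g ∈ E, g ≠ 1 → (g : X ≃ᵤ X) x ≠ x}

/-- The image `g(𝒱) = {g(V) | V ∈ 𝒱}` of a family of subsets under an automorphism. -/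
def imageCovering {X : Type*} [UniformSpace X] (g : X ≃ᵤ X) (𝒱 : Set (Set X)) : Set (Set X) :=
  (fun V => g '' V) '' 𝒱

end Automorphisms

section Means

/-- The space `UC_b(X)` of bounded uniformly continuous real-valued functions on `X`. -/
def UCb (X : Type*) [UniformSpace X] : Submodule ℝ (X → ℝ) where
  carrier := {f | UniformContinuous f ∧ ∃ C : ℝ, ∀ x, |f x| ≤ C}
  zero_mem' := ⟨uniformContinuous_const, 0, fun x => by simp⟩
  add_mem' := by
    rintro f g ⟨hf, C, hC⟩ ⟨hg, D, hD⟩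
    exact ⟨hf.add hg, C + D, fun x => (abs_add_le _ _).trans (add_le_add (hC x) (hD x))⟩
  smul_mem' := by
    rintro c f ⟨hf, C, hC⟩
    refine ⟨hf.const_smul c, |c| * C, fun x => ?_⟩
    simpa [abs_mul] using mul_le_mul_of_nonneg_left (hC x) (abs_nonneg c)

/-- The function `f ∘ g` for `f ∈ UC_b(X)` and `g ∈ Aut(X)`. -/
def UCb.comp {X : Type*} [UniformSpace X] (f : UCb X) (g : X ≃ᵤ X) : UCb X :=
  ⟨fun x => f.1 (g x), f.2.1.comp g.uniformContinuous,
    f.2.2.imp fun _ hC x => hC (g x)⟩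

/-- A mean on `UC_b(X)`: a linear functional `m` with `inf f ≤ m f ≤ sup f` for all `f`. -/
def IsMean {X : Type*} [UniformSpace X] (m : UCb X →ₗ[ℝ] ℝ) : Prop :=
  ∀ f : UCb X, (⨅ x, f.1 x) ≤ m f ∧ m f ≤ ⨆ x, f.1 x

/-- The dynamical system `(X, G)` is amenable if there is a mean on `UC_b(X)` that is invariant
under `G`. -/
def Amenable {X : Type*} [UniformSpace X] (G : Subgroup (X ≃ᵤ X)) : Prop :=
  ∃ m : UCb X →ₗ[ℝ] ℝ, IsMean m ∧ ∀ f : UCb X, ∀ g ∈ G, m f = m (UCb.comp f g)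

end Means

end UniformDynamics

namespace UniformDynamics

/-! Both directions rest on Hall's marriage theorem with a deficiency.

Small growth gives amenability (`amenable_of_forall_exists_refines`): let `𝒲` be a minimal
refinement of the join. If `𝒲` and `g(𝒲)` both refine `𝒱`, then replacing any `A ⊆ 𝒲` by the
translates `g(W')` that meet it gives another uniform covering refining `𝒱`, so it has at least
`N(𝒱)` members. This is Hall's condition with deficiency `#𝒲 - N(𝒱)`, a small proportion of `#𝒲`.
Averaging over one point per member of `𝒲` is thus almost `g`-invariant, and weak-* compactness
yields an invariant mean.

Amenability gives small growth (`exists_refines_of_amenable`): a Hahn-Banach separation and rounding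
of weights replace the mean by an average over `n` points. Perfectness and topological freeness move
them so that all `g(y j)`, `g ∈ E`, are distinct. Hall matches most `g(y j)` with nearby `y i`;
calling matched points by the same label needs only about `n` labels. Fattened label classes, plus
boundedly many sets avoiding all the points, form a covering `𝒲` with about `n` members. Put `𝒱 = ⋃
g⁻¹(𝒲)`: then `𝒲` refines the join, whereas no member of `𝒱` contains two of the `y j`, so `N(𝒱) ≥
n`. -/

/-! ### Uniform Urysohn functions -/

open Set Filter in
-- Repeatedly taking symmetric square roots of `D` produces a coarser, countably generated
-- uniformity still containing `D`; such uniformities are pseudometrizable.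
theorem exists_pseudoMetricSpace_of_mem_uniformity {X : Type*} [u : UniformSpace X]
    {D : Set (X × X)} (hD : D ∈ 𝓤 X) :
    ∃ I : PseudoMetricSpace X, u ≤ I.toUniformSpace ∧
      ∃ ε > 0, ∀ x y, I.dist x y < ε → (x, y) ∈ D := by
  have step : ∀ V : {V : SetRel X X // V ∈ 𝓤 X}, ∃ W : {V : SetRel X X // V ∈ 𝓤 X},
      SetRel.IsSymm W.1 ∧ W.1.comp W.1 ⊆ V.1 := by
    rintro ⟨V, hV⟩
    obtain ⟨W, hW, hs, hc⟩ := comp_symm_mem_uniformity_sets hV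
    exact ⟨⟨W, hW⟩, hs, hc⟩
  choose next hsymm hcomp using step
  let U : ℕ → {V : SetRel X X // V ∈ 𝓤 X} := fun n => Nat.rec (next ⟨D, hD⟩) (fun _ V => next V) n
  have hUsymm : ∀ n, SetRel.IsSymm (U n).1 := by
    rintro (_ | n) <;> exact hsymm _
  have hsub : ∀ V, (next V).1 ⊆ V.1 := fun V p hp =>
    hcomp V ⟨p.2, hp, refl_mem_uniformity (next V).2⟩
  have hanti : Antitone fun n => (U n).1 := antitone_nat_of_succ_le fun n => hsub (U n)
  let c : UniformSpace.Core X :=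
    { uniformity := ⨅ n, 𝓟 (U n).1
      refl := le_iInf fun n => by
        rw [principal_mono]
        rintro ⟨x, y⟩ (rfl : x = y)
        exact refl_mem_uniformity (U n).2
      symm := tendsto_iInf.2 fun n => tendsto_iInf' n <| by
        rw [tendsto_principal_principal]
        exact fun p hp => (hUsymm n).symm _ _ hp
      comp := le_iInf fun n => by
        refine le_principal_iff.2 ?_
        refine mem_of_superset (mem_lift' (mem_iInf_of_mem (n + 1) (mem_principal_self _))) ?_
        exact hcomp (U n) }
  let v : UniformSpace X := UniformSpace.ofCore c
  have hvb : (@uniformity X v).HasBasis (fun _ : ℕ => True) (fun n => (U n).1) :=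
    hasBasis_iInf_principal (directed_of_isDirected_le fun _ _ h => hanti h)
  have huv : u ≤ v := by
    refine UniformSpace.le_def.2 ?_
    exact le_iInf fun n => le_principal_iff.2 (U n).2
  have : IsCountablyGenerated (@uniformity X v) := hvb.isCountablyGenerated
  obtain ⟨I, hI⟩ := @UniformSpace.metrizable_uniformity X v _
  refine ⟨I, hI.symm ▸ huv, ?_⟩
  have hDv : D ∈ @uniformity X I.toUniformSpace := by
    rw [hI]
    exact mem_of_superset (hvb.mem_of_mem (i := 0) trivial) (hsub ⟨D, hD⟩)
  obtain ⟨ε, hε, h⟩ := Metric.mem_uniformity_dist.1 hDv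
  exact ⟨ε, hε, fun x y hxy => h hxy⟩

theorem uniformContinuous_max_one_sub_infDist {X : Type*} [PseudoMetricSpace X] (A : Set X)
    {ε : ℝ} (hε : 0 < ε) : UniformContinuous fun x => max 0 (1 - Metric.infDist x A / ε) := by
  have h : LipschitzWith (Real.toNNReal ε⁻¹) fun x : ℝ => max 0 (1 - x / ε) := by
    refine LipschitzWith.const_max (LipschitzWith.of_dist_le_mul fun x y => ?_) 0
    rw [Real.dist_eq, Real.dist_eq, Real.coe_toNNReal _ (by positivity),
      show 1 - x / ε - (1 - y / ε) = -(ε⁻¹ * (x - y)) by ring, abs_neg, abs_mul,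
      abs_of_pos (inv_pos.2 hε)]
  exact h.uniformContinuous.comp (Metric.uniformContinuous_infDist_pt A)

theorem exists_uniformContinuous_urysohn {X : Type*} [UniformSpace X]
    {D : Set (X × X)} (hD : D ∈ 𝓤 X) (A : Set X) :
    ∃ f : X → ℝ, UniformContinuous f ∧ (∀ x, 0 ≤ f x ∧ f x ≤ 1) ∧ (∀ x ∈ A, f x = 1) ∧
      ∀ x, f x ≠ 0 → ∃ a ∈ A, (a, x) ∈ D := by
  rcases A.eq_empty_or_nonempty with rfl | hA
  · exact ⟨fun _ => 0, uniformContinuous_const, by simp, by simp, by simp⟩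
  obtain ⟨I, hle, ε, hε, hI⟩ := exists_pseudoMetricSpace_of_mem_uniformity hD
  refine ⟨fun x => max 0 (1 - Metric.infDist x A / ε), ?_, fun x => ⟨le_max_left _ _, ?_⟩,
    fun x hx => ?_, fun x hx => ?_⟩
  · exact fun s hs => hle (@uniformContinuous_max_one_sub_infDist X I A ε hε s hs)
  · exact max_le zero_le_one (sub_le_self _ (div_nonneg Metric.infDist_nonneg hε.le))
  · simp [Metric.infDist_zero_of_mem hx]
  · have h : Metric.infDist x A < ε := by
      by_contra! h
      exact hx (max_eq_left (sub_nonpos.2 ((one_le_div hε).2 h)))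
    obtain ⟨a, ha, hxa⟩ := (Metric.infDist_lt_iff hA).1 h
    exact ⟨a, ha, hI a x (by rwa [← I.dist_comm] at hxa)⟩

/-! ### Matchings with deficiency -/

open Finset in
/-- Hall's marriage theorem with deficiency `d`. -/
theorem exists_injective_sum_fin_of_card_le {α β : Type*} [Fintype β] (r : α → β → Prop)
    [DecidableRel r] (d : ℕ) (h : ∀ A : Finset α, #A ≤ #{b | ∃ a ∈ A, r a b} + d) :
    ∃ f : α → β ⊕ Fin d, Function.Injective f ∧ ∀ a b, f a = Sum.inl b → r a b := by
  classical
  -- Add `d` dummy partners acceptable to everyone: the relation is vacuous on `Sum.inr`. Every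
  -- nonempty `A` then gains all `d` dummies.
  obtain ⟨f, hf, hr⟩ := (Fintype.all_card_le_filter_rel_iff_exists_injective
    (fun (a : α) (b : β ⊕ Fin d) => ∀ b', b = Sum.inl b' → r a b')).1 (by
      intro A
      rcases A.eq_empty_or_nonempty with rfl | ⟨a₀, ha₀⟩
      · simp
      refine (h A).trans ?_
      have hd : #{b | ∃ a ∈ A, r a b} + d =
          #(({b | ∃ a ∈ A, r a b} : Finset β).disjSum (univ : Finset (Fin d))) := by
        rw [Finset.card_disjSum, Finset.card_univ, Fintype.card_fin]
      rw [hd]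
      refine card_le_card fun b => ?_
      revert b
      rintro (b | k) hb
      · simpa using hb
      · simpa using ⟨a₀, ha₀⟩)
  exact ⟨f, hf, hr⟩

/-- Each matched term costs `ε`; by injectivity at most `d` terms are unmatched, and each of these
costs at most `C`. -/
theorem sum_le_sum_add_of_injective_sum_fin {ι κ : Type*} [Fintype ι] [Fintype κ] {d : ℕ}
    {f : ι → κ ⊕ Fin d} (hf : Function.Injective f) {a : ι → ℝ} {b : κ → ℝ} {C ε : ℝ}
    (hC : 0 ≤ C) (hε : 0 ≤ ε) (ha : ∀ i, a i ≤ C) (hb : ∀ j, 0 ≤ b j)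
    (hab : ∀ i j, f i = Sum.inl j → a i ≤ b j + ε) :
    ∑ i, a i ≤ ∑ j, b j + (Fintype.card ι * ε + d * C) := by
  classical
  let b' : κ ⊕ Fin d → ℝ := Sum.elim b fun _ => C
  have hb' : ∀ s, 0 ≤ b' s := by rintro (j | k); exacts [hb j, hC]
  have h1 : ∑ i, a i ≤ ∑ i, (b' (f i) + ε) := by
    refine Finset.sum_le_sum fun i _ => ?_
    rcases h : f i with j | k
    · exact hab i j h
    · exact (ha i).trans (le_add_of_nonneg_right hε)
  have h2 : ∑ i, b' (f i) ≤ ∑ s, b' s := by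
    rw [← Finset.sum_image (f := b') (s := Finset.univ) (g := f) (fun x _ y _ h => hf h)]
    exact Finset.sum_le_sum_of_subset_of_nonneg (Finset.subset_univ _) fun s _ _ => hb' s
  have h3 : ∑ s, b' s = ∑ j, b j + d * C := by
    simp [b', Fintype.sum_sum_type]
  rw [Finset.sum_add_distrib] at h1
  simp at h1
  linarith

/-! ### Finite coverings from bounded uniformly continuous maps -/

open Set in
theorem exists_finset_forall_dist_lt {X κ : Type*} [Fintype κ] {Φ : X → κ → ℝ}
    (hb : ∃ C, ∀ x k, |Φ x k| ≤ C) {r : ℝ} (hr : 0 < r) :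
    ∃ T : Finset (κ → ℝ), ∀ x, ∃ t ∈ T, dist (Φ x) t < r := by
  obtain ⟨C, hC⟩ := hb
  have hsub : range Φ ⊆ Metric.closedBall 0 (max C 0) := by
    rintro _ ⟨x, rfl⟩
    rw [mem_closedBall_zero_iff]
    exact (pi_norm_le_iff_of_nonneg (le_max_right _ _)).2 fun k =>
      (hC x k).trans (le_max_left _ _)
  obtain ⟨T, hT, h⟩ := Metric.totallyBounded_iff.1
    ((isCompact_closedBall _ _).totallyBounded.subset hsub) r hr
  refine ⟨hT.toFinset, fun x => ?_⟩
  simpa using h (mem_range_self x)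

theorem setOf_dist_lt_mem_uniformity {X Y : Type*} [UniformSpace X] [PseudoMetricSpace Y]
    {Φ : X → Y} (h : UniformContinuous Φ) {r : ℝ} (hr : 0 < r) :
    {p : X × X | dist (Φ p.1) (Φ p.2) < r} ∈ 𝓤 X :=
  h (Metric.dist_mem_uniformity hr)

/-- The preimages of finitely many small balls under a bounded uniformly continuous map form a
finite uniform covering. -/
theorem exists_finset_preimage_ball_mem_finiteUniformCoverings {X κ : Type*} [UniformSpace X]
    [Fintype κ] {Φ : X → κ → ℝ} (hΦ : UniformContinuous Φ) (hb : ∃ C, ∀ x k, |Φ x k| ≤ C)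
    {r : ℝ} (hr : 0 < r) :
    ∃ T : Finset (κ → ℝ), (fun t => {x | dist (Φ x) t < r}) '' T ∈ finiteUniformCoverings X := by
  obtain ⟨T, hT⟩ := exists_finset_forall_dist_lt hb (half_pos hr)
  refine ⟨T, T.finite_toSet.image _, _, setOf_dist_lt_mem_uniformity hΦ (half_pos hr), fun x => ?_⟩
  obtain ⟨t, ht, hxt⟩ := hT x
  refine ⟨_, ⟨t, ht, rfl⟩, fun y hy => ?_⟩
  have hy' : dist (Φ x) (Φ y) < r / 2 := hy
  have := dist_triangle_left (Φ y) t (Φ x)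
  exact this.trans_lt (by linarith)

/-! ### Uniform complexity -/

section Complexity

theorem Refines.rfl {X : Type*} {𝒰 : Set (Set X)} : Refines 𝒰 𝒰 := fun V hV => ⟨V, hV, subset_rfl⟩

theorem Refines.trans {X : Type*} {𝒰 𝒱 𝒲 : Set (Set X)} (h₁ : Refines 𝒲 𝒱) (h₂ : Refines 𝒱 𝒰) :
    Refines 𝒲 𝒰 := fun W hW =>
  let ⟨V, hV, hWV⟩ := h₁ W hW
  let ⟨U, hU, hVU⟩ := h₂ V hV
  ⟨U, hU, hWV.trans hVU⟩

variable {X : Type*} [UniformSpace X]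

theorem uniformComplexity_le_ncard {𝒰 𝒱 : Set (Set X)} (h : 𝒱 ∈ finiteUniformCoverings X)
    (hr : Refines 𝒱 𝒰) : uniformComplexity 𝒰 ≤ 𝒱.ncard :=
  Nat.sInf_le ⟨𝒱, h, hr, rfl⟩

theorem exists_refines_ncard_eq_uniformComplexity {𝒰 : Set (Set X)}
    (h : 𝒰 ∈ finiteUniformCoverings X) :
    ∃ 𝒱 ∈ finiteUniformCoverings X, Refines 𝒱 𝒰 ∧ 𝒱.ncard = uniformComplexity 𝒰 :=
  Nat.sInf_mem (s := {n | ∃ 𝒱 ∈ finiteUniformCoverings X, Refines 𝒱 𝒰 ∧ 𝒱.ncard = n})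
    ⟨_, 𝒰, h, Refines.rfl, rfl⟩

theorem uniformComplexity_mono {𝒰 𝒱 : Set (Set X)} (h : 𝒱 ∈ finiteUniformCoverings X)
    (hr : Refines 𝒱 𝒰) : uniformComplexity 𝒰 ≤ uniformComplexity 𝒱 := by
  obtain ⟨𝒲, h𝒲, hr', hc⟩ := exists_refines_ncard_eq_uniformComplexity h
  exact hc ▸ uniformComplexity_le_ncard h𝒲 (hr'.trans hr)

theorem exists_mem_of_isUniformCovering {𝒰 : Set (Set X)} (h : IsUniformCovering 𝒰) (x : X) :
    ∃ U ∈ 𝒰, x ∈ U := by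
  obtain ⟨D, hD, h⟩ := h
  obtain ⟨U, hU, hx⟩ := h x
  exact ⟨U, hU, hx (refl_mem_uniformity hD)⟩

theorem uniformComplexity_pos [Nonempty X] {𝒰 : Set (Set X)}
    (h : 𝒰 ∈ finiteUniformCoverings X) : 0 < uniformComplexity 𝒰 := by
  obtain ⟨𝒱, h𝒱, -, hc⟩ := exists_refines_ncard_eq_uniformComplexity h
  obtain ⟨U, hU, -⟩ := exists_mem_of_isUniformCovering h𝒱.2 (Classical.arbitrary X)
  exact hc ▸ (Set.ncard_pos h𝒱.1).2 ⟨U, hU⟩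

theorem preimage_mem_uniformity (g : X ≃ᵤ X) {D : Set (X × X)} (hD : D ∈ 𝓤 X) :
    {p : X × X | (g p.1, g p.2) ∈ D} ∈ 𝓤 X :=
  g.uniformContinuous hD

theorem imageCovering_mem_finiteUniformCoverings (g : X ≃ᵤ X) {𝒱 : Set (Set X)}
    (h : 𝒱 ∈ finiteUniformCoverings X) : imageCovering g 𝒱 ∈ finiteUniformCoverings X := by
  obtain ⟨hf, D, hD, h⟩ := h
  refine ⟨hf.image _, _, preimage_mem_uniformity g.symm hD, fun x => ?_⟩
  obtain ⟨V, hV, hxV⟩ := h (g.symm x)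
  exact ⟨_, ⟨V, hV, rfl⟩, fun y hy => ⟨g.symm y, hxV hy, g.apply_symm_apply y⟩⟩

theorem join_mem_finiteUniformCoverings {ι : Type*} [Finite ι] {𝒰 : ι → Set (Set X)}
    (h : ∀ i, 𝒰 i ∈ finiteUniformCoverings X) : join 𝒰 ∈ finiteUniformCoverings X := by
  choose hf D hD h using h
  refine ⟨((Set.Finite.pi' hf).image fun U => ⋂ i, U i).subset ?_, ⋂ i, D i,
    (Filter.iInter_mem).2 hD, fun x => ?_⟩
  · rintro _ ⟨U, hU, rfl⟩
    exact ⟨U, hU, rfl⟩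
  · choose U hU hx using fun i => h i x
    refine ⟨_, ⟨U, hU, rfl⟩, Set.subset_iInter fun i y hy => hx i ?_⟩
    exact Set.mem_iInter.1 hy i

end Complexity

/-! ### Means and weak-* compactness -/

section Means

variable {X : Type*} [UniformSpace X]

open Set in
theorem bddAbove_range_UCb (f : UCb X) : BddAbove (range f.1) := by
  obtain ⟨-, C, hC⟩ := f.2
  exact ⟨C, by rintro _ ⟨x, rfl⟩; exact (abs_le.1 (hC x)).2⟩

open Set in
theorem bddBelow_range_UCb (f : UCb X) : BddBelow (range f.1) := by
  obtain ⟨-, C, hC⟩ := f.2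
  exact ⟨-C, by rintro _ ⟨x, rfl⟩; exact (abs_le.1 (hC x)).1⟩

/-- The average over a finite family of points. -/
noncomputable def average {ι : Type*} [Fintype ι] (x : ι → X) : UCb X →ₗ[ℝ] ℝ where
  toFun f := (Fintype.card ι : ℝ)⁻¹ * ∑ i, f.1 (x i)
  map_add' f g := by
    simp [Finset.sum_add_distrib, mul_add]
  map_smul' c f := by
    simp only [Submodule.coe_smul, Pi.smul_apply, smul_eq_mul, ← Finset.mul_sum, RingHom.id_apply]
    ring

theorem average_apply {ι : Type*} [Fintype ι] (x : ι → X) (f : UCb X) :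
    average x f = (Fintype.card ι : ℝ)⁻¹ * ∑ i, f.1 (x i) := rfl

theorem isMean_average {ι : Type*} [Fintype ι] [Nonempty ι] (x : ι → X) : IsMean (average x) := by
  intro f
  have hc : (0 : ℝ) < Fintype.card ι := by exact_mod_cast Fintype.card_pos
  rw [average_apply, inv_mul_eq_div, le_div_iff₀ hc, div_le_iff₀ hc]
  constructor
  · calc (⨅ x, f.1 x) * Fintype.card ι = ∑ _i : ι, ⨅ x, f.1 x := by simp [mul_comm]
      _ ≤ _ := Finset.sum_le_sum fun i _ => ciInf_le (bddBelow_range_UCb f) (x i)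
  · calc ∑ i, f.1 (x i) ≤ ∑ _i : ι, ⨆ x, f.1 x :=
          Finset.sum_le_sum fun i _ => le_ciSup (bddAbove_range_UCb f) (x i)
      _ = _ := by simp [mul_comm]

open Filter Topology in
/-- Weak-* compactness: approximately invariant means yield an invariant mean. -/
theorem amenable_of_forall_exists_isMean {G : Subgroup (X ≃ᵤ X)}
    (h : ∀ (F : Finset G) (S : Finset (UCb X)) (ε : ℝ), 0 < ε → ∃ m : UCb X →ₗ[ℝ] ℝ, IsMean m ∧
      ∀ g ∈ F, ∀ f ∈ S, m f ≤ m (UCb.comp f g) + ε) : Amenable G := by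
  classical
  have h' : ∀ i : Finset G × Finset (UCb X) × ℕ, ∃ m : UCb X →ₗ[ℝ] ℝ, IsMean m ∧
      ∀ g ∈ i.1, ∀ f ∈ i.2.1, m f ≤ m (UCb.comp f g) + 1 / ((i.2.2 : ℝ) + 1) :=
    fun i => h i.1 i.2.1 _ Nat.one_div_pos_of_nat
  choose M hM hinv using h'
  let u : Ultrafilter (Finset G × Finset (UCb X) × ℕ) := Ultrafilter.of atTop
  have hu : (u : Filter (Finset G × Finset (UCb X) × ℕ)) ≤ atTop := Ultrafilter.of_le atTop
  have hlim : ∀ f : UCb X, ∃ y ∈ Set.Icc (⨅ x, f.1 x) (⨆ x, f.1 x),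
      Tendsto (fun i => M i f) u (𝓝 y) := by
    intro f
    exact isCompact_Icc.ultrafilter_le_nhds' (u.map fun i => M i f)
      (Filter.mem_map.2 (Filter.univ_mem' fun i => hM i f))
  choose m hm hlim using hlim
  have hle : ∀ (f : UCb X), ∀ g ∈ G, m f ≤ m (UCb.comp f g) := by
    intro f g hg
    have h1 : Tendsto (fun i : Finset G × Finset (UCb X) × ℕ =>
        M i (UCb.comp f g) + 1 / ((i.2.2 : ℝ) + 1)) u (𝓝 (m (UCb.comp f g) + 0)) := by
      refine (hlim _).add ?_
      refine Tendsto.mono_left ?_ hu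
      refine tendsto_one_div_add_atTop_nhds_zero_nat.comp ?_
      rw [← prod_atTop_atTop_eq, ← prod_atTop_atTop_eq]
      exact tendsto_snd.comp tendsto_snd
    rw [add_zero] at h1
    refine le_of_tendsto_of_tendsto (hlim f) h1 ?_
    have h2 : ∀ᶠ i in atTop, (({⟨g, hg⟩}, {f}, 0) : Finset G × Finset (UCb X) × ℕ) ≤ i :=
      eventually_ge_atTop _
    filter_upwards [hu h2] with i hi
    exact hinv i ⟨g, hg⟩ (hi.1 (by simp)) f (hi.2.1 (by simp))
  let m' : UCb X →ₗ[ℝ] ℝ :=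
    { toFun := m
      map_add' := fun f g => tendsto_nhds_unique (hlim _) <| by
        simpa using (hlim f).add (hlim g)
      map_smul' := fun c f => tendsto_nhds_unique (hlim _) <| by
        simpa using (hlim f).const_mul c }
  refine ⟨m', hm, fun f g hg => le_antisymm (hle f g hg) ?_⟩
  -- The reverse inequality is the one already proved, applied to `-f`.
  have h1 := hle (-f) g hg
  have h2 : m (-f) = -m f := m'.map_neg f
  have h3 : m (UCb.comp (-f) g) = -m (UCb.comp f g) := m'.map_neg (UCb.comp f g)
  rw [h2, h3] at h1
  exact neg_le_neg_iff.1 h1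

end Means

/-! ### From small growth to an invariant mean -/

section Matching

variable {X : Type*} [UniformSpace X]

open Finset in
/-- If the finite uniform covering `𝒲` and its image under `g` both refine `𝒱`, then all but
`#𝒲 - N(𝒱)` members `W` can be matched injectively with members `W'` such that `g(W')` meets
`W`. -/
theorem exists_matching_of_refines {𝒱 𝒲 : Set (Set X)} [Fintype 𝒲] (g : X ≃ᵤ X)
    (h𝒲 : 𝒲 ∈ finiteUniformCoverings X) (h₁ : Refines 𝒲 𝒱) (h₂ : Refines (imageCovering g 𝒲) 𝒱) :
    ∃ f : 𝒲 → 𝒲 ⊕ Fin (Fintype.card 𝒲 - uniformComplexity 𝒱), Function.Injective f ∧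
      ∀ W W' : 𝒲, f W = Sum.inl W' → ∃ y ∈ W'.1, g y ∈ W.1 := by
  classical
  refine exists_injective_sum_fin_of_card_le (fun W W' : 𝒲 => ∃ y ∈ W'.1, g y ∈ W.1) _ fun A => ?_
  set B : Finset 𝒲 := {W' | ∃ W ∈ A, ∃ y ∈ W'.1, g y ∈ W.1} with hB
  -- The members in `A` are exchanged for the `g`-translates meeting them. The result still covers
  -- uniformly, so `N(𝒱) ≤ #𝒲 - #A + #B`.
  let 𝒵 : Finset (Set X) := (univ \ A).image (fun W : 𝒲 => W.1) ∪ B.image (fun W : 𝒲 => g '' W.1)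
  have hr : Refines (𝒵 : Set (Set X)) 𝒱 := by
    intro Z hZ
    simp only [𝒵, coe_union, coe_image, Set.mem_union, Set.mem_image] at hZ
    rcases hZ with ⟨W, -, rfl⟩ | ⟨W, -, rfl⟩
    · exact h₁ W W.2
    · exact h₂ _ ⟨W, W.2, rfl⟩
  have hu : (𝒵 : Set (Set X)) ∈ finiteUniformCoverings X := by
    refine ⟨𝒵.finite_toSet, ?_⟩
    obtain ⟨-, D, hD, h⟩ := h𝒲
    refine ⟨_, Filter.inter_mem hD (preimage_mem_uniformity g.symm hD), fun x => ?_⟩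
    obtain ⟨W, hW, hxW⟩ := h x
    by_cases hA : (⟨W, hW⟩ : 𝒲) ∈ A
    · obtain ⟨W', hW', hxW'⟩ := h (g.symm x)
      refine ⟨g '' W', ?_, fun y hy => ⟨g.symm y, hxW' hy.2, g.apply_symm_apply y⟩⟩
      refine mem_coe.2 (mem_union_right _ (mem_image.2 ⟨⟨W', hW'⟩, ?_, rfl⟩))
      refine mem_filter.2 ⟨mem_univ _, ⟨W, hW⟩, hA, g.symm x, hxW' (refl_mem_uniformity hD), ?_⟩
      rw [g.apply_symm_apply]
      exact hxW (refl_mem_uniformity hD)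
    · refine ⟨W, ?_, fun y hy => hxW hy.1⟩
      exact mem_coe.2 (mem_union_left _ (mem_image.2 ⟨⟨W, hW⟩, by simpa using hA, rfl⟩))
  have h3 := uniformComplexity_le_ncard hu hr
  rw [Set.ncard_coe_finset] at h3
  have h4 : #𝒵 ≤ #(univ \ A) + #B :=
    (card_union_le _ _).trans (add_le_add card_image_le card_image_le)
  have h5 := card_sdiff_add_card_eq_card (subset_univ A)
  rw [card_univ] at h5
  omega

end Matching

open Set in
theorem amenable_of_forall_exists_refines {X : Type*} [UniformSpace X] [Nonempty X]
    {G : Subgroup (X ≃ᵤ X)}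
    (H : ∀ (E : Finset G), ∀ 𝒰 ∈ finiteUniformCoverings X, ∀ ε : ℝ, 0 < ε →
      ∃ 𝒱 ∈ finiteUniformCoverings X, Refines 𝒱 𝒰 ∧
        (uniformComplexity (join fun g : E => imageCovering (g : X ≃ᵤ X) 𝒱) : ℝ) ≤
          (1 + ε) * uniformComplexity 𝒱) : Amenable G := by
  classical
  refine amenable_of_forall_exists_isMean fun F S ε hε => ?_
  have hC : ∃ C : ℝ, 0 ≤ C ∧ ∀ f ∈ S, ∀ x, |f.1 x| ≤ C := by
    choose C hC using fun f : UCb X => f.2.2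
    refine ⟨∑ f ∈ S, |C f|, Finset.sum_nonneg fun f _ => abs_nonneg _, fun f hf x => ?_⟩
    exact (hC f x).trans ((le_abs_self _).trans
      (Finset.single_le_sum (f := fun f => |C f|) (fun f _ => abs_nonneg _) hf))
  obtain ⟨C, hC0, hC⟩ := hC
  let Φ : X → S → ℝ := fun x f => f.1.1 x
  have hΦ : UniformContinuous Φ := uniformContinuous_pi.2 fun f => f.1.2.1
  obtain ⟨T, hT⟩ := exists_finset_preimage_ball_mem_finiteUniformCoverings hΦ
    ⟨C, fun x f => hC f f.2 x⟩ (show 0 < ε / 8 by positivity)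
  -- The element `1` makes `𝒲` refine `𝒱`, and `g⁻¹` makes `g(𝒲)` refine `𝒱`. Radius `ε / 8` bounds
  -- oscillation on a member by `ε / 4`; a matched pair crosses two members, costing `ε / 2`. The
  -- growth constant keeps the unmatched terms, each at most `2 * C`, within the other `ε / 2`.
  obtain ⟨𝒱, h𝒱, hr𝒱, hN⟩ := H (insert 1 (F.image fun g => g⁻¹)) _ hT (ε / (4 * (C + 1)))
    (by positivity)
  set E : Finset G := insert 1 (F.image fun g => g⁻¹) with hE
  have hosc : ∀ V ∈ 𝒱, ∀ f ∈ S, ∀ x ∈ V, ∀ y ∈ V, f.1 x ≤ f.1 y + ε / 4 := by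
    intro V hV f hf x hx y hy
    obtain ⟨_, ⟨t, -, rfl⟩, hVt⟩ := hr𝒱 V hV
    have h1 : dist (Φ x) (Φ y) < ε / 8 + ε / 8 :=
      (dist_triangle_right _ _ t).trans_lt (add_lt_add (hVt hx) (hVt hy))
    have h2 := (dist_le_pi_dist (Φ x) (Φ y) ⟨f, hf⟩).trans_lt h1
    have h3 := (abs_lt.1 (Real.dist_eq _ _ ▸ h2)).2
    simp only [Φ] at h3
    linarith
  have hjoin : join (fun g : E => imageCovering (g : X ≃ᵤ X) 𝒱) ∈ finiteUniformCoverings X :=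
    join_mem_finiteUniformCoverings fun g => imageCovering_mem_finiteUniformCoverings _ h𝒱
  obtain ⟨𝒲, h𝒲, hr𝒲, hcard⟩ := exists_refines_ncard_eq_uniformComplexity hjoin
  have : Fintype 𝒲 := h𝒲.1.fintype
  have hrefine : ∀ g ∈ E, Refines 𝒲 (imageCovering (g : X ≃ᵤ X) 𝒱) := by
    intro g hg W hW
    obtain ⟨_, ⟨U, hU, rfl⟩, hWU⟩ := hr𝒲 W hW
    exact ⟨U ⟨g, hg⟩, hU ⟨g, hg⟩, hWU.trans (iInter_subset _ _)⟩
  have h1 : Refines 𝒲 𝒱 := by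
    intro W hW
    obtain ⟨_, ⟨V, hV, rfl⟩, hWV⟩ := hrefine 1 (by simp [hE]) W hW
    refine ⟨V, hV, fun x hx => ?_⟩
    obtain ⟨y, hy, rfl⟩ := hWV hx
    exact hy
  have hcard' : Fintype.card 𝒲 = uniformComplexity
      (join (fun g : E => imageCovering (g : X ≃ᵤ X) 𝒱)) := by
    rw [← hcard, ← Nat.card_eq_fintype_card]; rfl
  have hle : uniformComplexity 𝒱 ≤ Fintype.card 𝒲 := by
    have := uniformComplexity_le_ncard h𝒲 h1
    omega
  -- An empty member may get any point, since matched members are never empty.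
  have hx : ∀ W : 𝒲, ∃ x : X, W.1.Nonempty → x ∈ W.1 := by
    intro W
    by_cases h : W.1.Nonempty
    · exact ⟨h.some, fun _ => h.some_mem⟩
    · exact ⟨Classical.arbitrary X, fun h' => absurd h' h⟩
  choose x hx using hx
  have hne : Nonempty 𝒲 := by
    obtain ⟨W, hW, -⟩ := exists_mem_of_isUniformCovering h𝒲.2 (Classical.arbitrary X)
    exact ⟨⟨W, hW⟩⟩
  refine ⟨average x, isMean_average x, fun g hg f hf => ?_⟩
  have h2 : Refines (imageCovering (g : X ≃ᵤ X) 𝒲) 𝒱 := by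
    rintro _ ⟨W, hW, rfl⟩
    obtain ⟨_, ⟨V, hV, rfl⟩, hWV⟩ := hrefine g⁻¹
      (Finset.mem_insert_of_mem (Finset.mem_image_of_mem _ hg)) W hW
    refine ⟨V, hV, ?_⟩
    rintro _ ⟨y, hy, rfl⟩
    obtain ⟨z, hz, rfl⟩ := hWV hy
    convert hz
    exact (g : X ≃ᵤ X).apply_symm_apply z
  obtain ⟨φ, hφ, hφr⟩ := exists_matching_of_refines (g : X ≃ᵤ X) h𝒲 h1 h2
  have hsum := sum_le_sum_add_of_injective_sum_fin hφ
    -- Shifting by `C` puts the values in `[0, 2 * C]`.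
    (a := fun W => f.1 (x W) + C) (b := fun W => f.1 ((g : X ≃ᵤ X) (x W)) + C)
    (C := 2 * C) (ε := ε / 2) (by positivity) (by positivity)
    (fun W => by have := (abs_le.1 (hC f hf (x W))).2; linarith)
    (fun W => by have := (abs_le.1 (hC f hf ((g : X ≃ᵤ X) (x W)))).1; linarith)
    (fun W W' hWW' => by
      obtain ⟨y, hy, hgy⟩ := hφr W W' hWW'
      obtain ⟨V, hV, hWV⟩ := h1 W W.2
      obtain ⟨V', hV', hWV'⟩ := h2 _ ⟨W', W'.2, rfl⟩
      have e1 := hosc V hV f hf _ (hWV (hx W ⟨_, hgy⟩)) _ (hWV hgy)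
      have e2 := hosc V' hV' f hf _ (hWV' ⟨y, hy, rfl⟩) _ (hWV' ⟨_, hx W' ⟨y, hy⟩, rfl⟩)
      linarith)
  simp only [Finset.sum_add_distrib] at hsum
  have hn : (0 : ℝ) < Fintype.card 𝒲 := by exact_mod_cast Fintype.card_pos
  have hd : ((Fintype.card 𝒲 - uniformComplexity 𝒱 : ℕ) : ℝ) * (2 * C) ≤
      Fintype.card 𝒲 * (ε / 2) := by
    rw [← hcard'] at hN
    rw [Nat.cast_sub hle]
    have hle' : (uniformComplexity 𝒱 : ℝ) ≤ Fintype.card 𝒲 := by exact_mod_cast hle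
    have e1 : (Fintype.card 𝒲 : ℝ) - uniformComplexity 𝒱 ≤
        ε / (4 * (C + 1)) * Fintype.card 𝒲 := by
      have : ε / (4 * (C + 1)) * uniformComplexity 𝒱 ≤ ε / (4 * (C + 1)) * Fintype.card 𝒲 := by
        gcongr
      linarith
    calc _ ≤ ε / (4 * (C + 1)) * Fintype.card 𝒲 * (2 * (C + 1)) := by gcongr; linarith
      _ = _ := by field_simp; ring
  rw [average_apply, average_apply, inv_mul_eq_div, inv_mul_eq_div, div_add' _ _ _ hn.ne']
  refine div_le_div_of_nonneg_right ?_ hn.le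
  change ∑ i, f.1 (x i) ≤ ∑ i, f.1 ((g : X ≃ᵤ X) (x i)) + ε * Fintype.card 𝒲
  linarith

/-! ### Approximating a mean by finitely many points -/

open Set in
-- Otherwise the coefficients of a separating functional combine the `T k` into a function bounded
-- below by some `u > 0`, whose mean would nevertheless be `0`.
theorem zero_mem_closure_convexHull_of_isMean {X κ : Type*} [UniformSpace X] [Nonempty X]
    [Fintype κ] {m : UCb X →ₗ[ℝ] ℝ} (hm : IsMean m) (T : κ → UCb X) (hT : ∀ k, m (T k) = 0) :
    (0 : κ → ℝ) ∈ closure (convexHull ℝ (range fun x k => (T k).1 x)) := by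
  classical
  by_contra h
  obtain ⟨f, u, h0, hu⟩ := geometric_hahn_banach_point_closed
    (convex_convexHull ℝ (range fun x k => (T k).1 x)).closure isClosed_closure h
  rw [map_zero] at h0
  let F : UCb X := ∑ k, f (Pi.single k 1) • T k
  have hF : m F = 0 := by simp [F, hT]
  have hFx : ∀ x, u ≤ F.1 x := by
    intro x
    refine (hu _ (subset_closure (subset_convexHull ℝ _ (mem_range_self x)))).le.trans_eq ?_
    rw [← LinearMap.sum_single_apply (fun _ => ℝ) (fun k => (T k).1 x), map_sum]
    simp only [F, AddSubmonoidClass.coe_finsetSum, Finset.sum_apply]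
    refine Finset.sum_congr rfl fun k _ => ?_
    have : (Pi.single k ((T k).1 x) : κ → ℝ) = (T k).1 x • (Pi.single k (1 : ℝ) : κ → ℝ) := by
      simp [← Pi.single_smul]
    rw [this, map_smul, smul_eq_mul, mul_comm]
    rfl
  have := (le_ciInf hFx).trans (hm F).1
  linarith

open Set in
-- A convex combination nearly killing all `T k` becomes an unweighted sum by repeating each point
-- `⌊M * w i⌋₊` times, with `M` large.
theorem exists_fin_sum_le_of_isMean {X κ : Type*} [UniformSpace X] [Nonempty X]
    [Fintype κ] {m : UCb X →ₗ[ℝ] ℝ} (hm : IsMean m) (T : κ → UCb X) (hT : ∀ k, m (T k) = 0)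
    {δ : ℝ} (hδ : 0 < δ) (N : ℕ) :
    ∃ n ≥ N, ∃ x : Fin n → X, ∀ k, |∑ j, (T k).1 (x j)| ≤ δ * n := by
  obtain ⟨b, hb, hbδ⟩ := Metric.mem_closure_iff.1
    (zero_mem_closure_convexHull_of_isMean hm T hT) (δ / 2) (half_pos hδ)
  rw [dist_zero_left] at hbδ
  obtain ⟨ι, _, w, z, hw, hw1, hz, rfl⟩ := mem_convexHull_iff_exists_fintype.1 hb
  choose p hp using hz
  obtain ⟨C, hC0, hC⟩ : ∃ C : ℝ, 0 ≤ C ∧ ∀ k x, |(T k).1 x| ≤ C := by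
    choose C hC using fun f : UCb X => f.2.2
    refine ⟨∑ k, |C (T k)|, Finset.sum_nonneg fun f _ => abs_nonneg _, fun k x => ?_⟩
    exact (hC (T k) x).trans ((le_abs_self _).trans (Finset.single_le_sum
      (f := fun k => |C (T k)|) (fun k _ => abs_nonneg _) (Finset.mem_univ k)))
  -- Rounding loses at most `card ι` points, whence the first bound. The second absorbs the rounding
  -- error `card ι * C` and the loss `δ * card ι` from having `n ≥ M - card ι`.
  obtain ⟨M, hM⟩ := exists_nat_ge
    (max ((N : ℝ) + Fintype.card ι) (2 / δ * (Fintype.card ι * (C + δ))))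
  have hM1 := (le_max_left _ _).trans hM
  have hM2 := (le_max_right _ _).trans hM
  let c : ι → ℕ := fun i => ⌊M * w i⌋₊
  have hc1 : ∀ i, (c i : ℝ) ≤ M * w i := fun i =>
    Nat.floor_le (mul_nonneg (Nat.cast_nonneg _) (hw i))
  have hc2 : ∀ i, M * w i ≤ c i + 1 := fun i => (Nat.lt_floor_add_one _).le
  let J := Σ i, Fin (c i)
  have hJ : Fintype.card J = ∑ i, c i := by simp [J]
  have hn : (M : ℝ) - Fintype.card ι ≤ Fintype.card J := by
    have h1 : ∑ i, M * w i ≤ ∑ i, ((c i : ℝ) + 1) := Finset.sum_le_sum fun i _ => hc2 i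
    rw [← Finset.mul_sum, hw1, Finset.sum_add_distrib] at h1
    simp at h1
    rw [hJ]
    push_cast
    linarith
  refine ⟨Fintype.card J, ?_, fun j => p ((Fintype.equivFin J).symm j).1, fun k => ?_⟩
  · have : (N : ℝ) ≤ Fintype.card J := by linarith
    exact_mod_cast this
  · have h1 : ∑ j, (T k).1 (p ((Fintype.equivFin J).symm j).1) = ∑ i, c i * (T k).1 (p i) := by
      rw [(Fintype.equivFin J).symm.sum_comp (fun s : J => (T k).1 (p s.1)), Fintype.sum_sigma]
      simp
    have h2 : |∑ i, w i * (T k).1 (p i)| < δ / 2 := by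
      have := (norm_le_pi_norm (∑ i, w i • z i) k).trans_lt hbδ
      simpa [← hp] using this
    have h3 : |∑ i, c i * (T k).1 (p i) - M * ∑ i, w i * (T k).1 (p i)| ≤ Fintype.card ι * C := by
      rw [Finset.mul_sum, ← Finset.sum_sub_distrib]
      refine (Finset.abs_sum_le_sum_abs _ _).trans ?_
      refine (Finset.sum_le_card_nsmul _ _ C fun i _ => ?_).trans_eq (by simp)
      rw [← mul_assoc, ← sub_mul, abs_mul]
      have : |(c i : ℝ) - M * w i| ≤ 1 := abs_le.2 ⟨by linarith [hc2 i], by linarith [hc1 i]⟩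
      exact (mul_le_mul this (hC k _) (abs_nonneg _) zero_le_one).trans_eq (one_mul C)
    have h4 : |∑ i, c i * (T k).1 (p i)| ≤ M * (δ / 2) + Fintype.card ι * C := by
      have h5 := abs_add_le (∑ i, c i * (T k).1 (p i) - M * ∑ i, w i * (T k).1 (p i))
        (M * ∑ i, w i * (T k).1 (p i))
      rw [sub_add_cancel, abs_mul, Nat.abs_cast] at h5
      have h6 : (M : ℝ) * |∑ i, w i * (T k).1 (p i)| ≤ M * (δ / 2) := by gcongr
      linarith
    rw [h1]
    refine h4.trans ?_
    have h7 : (Fintype.card ι : ℝ) * (C + δ) ≤ M * (δ / 2) := by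
      have h8 := mul_le_mul_of_nonneg_right hM2 (half_pos hδ).le
      have : 2 / δ * (Fintype.card ι * (C + δ)) * (δ / 2) = Fintype.card ι * (C + δ) := by
        field_simp
      linarith
    nlinarith [mul_le_mul_of_nonneg_left hn hδ.le]

/-! ### General position -/

open Topology in
theorem perfectSpace_neBot {X : Type*} [TopologicalSpace X] [PerfectSpace X] (x : X) :
    (𝓝[≠] x).NeBot := by
  have := PerfectSpace.univ_preperfect (α := X) x (Set.mem_univ x)
  simpa [AccPt] using this

open Set in
/-- Points can be moved into general position with respect to a topologically free action. -/
theorem TopologicallyFree.exists_injective {X : Type*} [UniformSpace X] [T2Space X]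
    [PerfectSpace X] [Nonempty X] {G : Subgroup (X ≃ᵤ X)} (hG : TopologicallyFree G) (E : Finset G)
    {ι : Type*} [Fintype ι] (O : ι → Set X) (hO : ∀ i, IsOpen (O i)) (hne : ∀ i, (O i).Nonempty) :
    ∃ y : ι → X, (∀ i, y i ∈ O i) ∧
      Function.Injective fun p : E × ι => (p.1.1 : X ≃ᵤ X) (y p.2) := by
  classical
  have key : ∀ s : Finset ι, ∃ y : ι → X, (∀ i ∈ s, y i ∈ O i) ∧
      ∀ g ∈ E, ∀ h ∈ E, ∀ i ∈ s, ∀ j ∈ s, (g : X ≃ᵤ X) (y i) = (h : X ≃ᵤ X) (y j) →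
        g = h ∧ i = j := by
    intro s
    induction s using Finset.induction_on with
    | empty => exact ⟨fun _ => Classical.arbitrary X, by simp, by simp⟩
    | insert a s ha ih =>
      obtain ⟨y, hy, hinj⟩ := ih
      have hnb : ∀ x : X, (nhdsWithin x {x}ᶜ).NeBot := perfectSpace_neBot
      -- The points whose `E`-translates would collide with those already chosen. Without isolated
      -- points, removing this finite set keeps the free points dense.
      let P : Finset X := ((E ×ˢ E) ×ˢ s).image fun q =>
        (q.1.1 : X ≃ᵤ X).symm ((q.1.2 : X ≃ᵤ X) (y q.2))
      obtain ⟨z, hzO, hz, hzP⟩ := ((hG ((E ×ˢ E).image fun q => q.1⁻¹ * q.2)).sdiff_finset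
        P).inter_open_nonempty (O a) (hO a) (hne a)
      have hfree : ∀ g ∈ E, ∀ h ∈ E, (g : X ≃ᵤ X) z = (h : X ≃ᵤ X) z → g = h := by
        intro g hg h hh hgh
        by_contra hne
        refine hz (g⁻¹ * h) (Finset.mem_image.2 ⟨(g, h), Finset.mk_mem_product hg hh, rfl⟩) ?_ ?_
        · rwa [Ne, inv_mul_eq_one]
        · change (g : X ≃ᵤ X).symm ((h : X ≃ᵤ X) z) = z
          rw [← hgh]
          exact (g : X ≃ᵤ X).symm_apply_apply z
      have hnew : ∀ g ∈ E, ∀ h ∈ E, ∀ j ∈ s, (g : X ≃ᵤ X) z ≠ (h : X ≃ᵤ X) (y j) := by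
        intro g hg h hh j hj hgh
        refine hzP (Finset.mem_coe.2 (Finset.mem_image.2 ⟨((g, h), j),
          Finset.mk_mem_product (Finset.mk_mem_product hg hh) hj, ?_⟩))
        change (g : X ≃ᵤ X).symm ((h : X ≃ᵤ X) (y j)) = z
        rw [← hgh]
        exact (g : X ≃ᵤ X).symm_apply_apply z
      have hyu : ∀ i ∈ s, Function.update y a z i = y i := fun i hi =>
        Function.update_of_ne (by rintro rfl; exact ha hi) _ _
      refine ⟨Function.update y a z, ?_, ?_⟩
      · intro i hi
        rcases Finset.mem_insert.1 hi with rfl | hi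
        · simpa using hzO
        · simpa [hyu i hi] using hy i hi
      · intro g hg h hh i hi j hj
        rcases Finset.mem_insert.1 hi with hia | hi' <;>
          rcases Finset.mem_insert.1 hj with hja | hj'
        · rw [hia, hja, Function.update_self]
          exact fun e => ⟨hfree g hg h hh e, rfl⟩
        · rw [hia, Function.update_self, hyu j hj']
          exact fun e => absurd e (hnew g hg h hh j hj')
        · rw [hja, Function.update_self, hyu i hi']
          exact fun e => absurd e.symm (hnew h hh g hg i hi')
        · rw [hyu i hi', hyu j hj']
          exact hinj g hg h hh i hi' j hj'
  obtain ⟨y, hy, hinj⟩ := key Finset.univ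
  refine ⟨y, fun i => hy i (Finset.mem_univ i), ?_⟩
  rintro ⟨g, i⟩ ⟨h, j⟩ e
  obtain ⟨h1, h2⟩ := hinj g g.2 h h.2 i (Finset.mem_univ i) j (Finset.mem_univ j) e
  exact Prod.ext (Subtype.ext h1) h2

/-! ### Encoding coverings by maps, and separating points -/

/-- A finite uniform covering is refined by the small sets of a bounded uniformly continuous map
into a finite-dimensional space. -/
theorem exists_uniformContinuous_forall_exists_subset {X : Type*} [UniformSpace X]
    {𝒰 : Set (Set X)} (h : IsUniformCovering 𝒰) [Fintype 𝒰] :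
    ∃ Φ : X → 𝒰 → ℝ, UniformContinuous Φ ∧ (∀ x U, |Φ x U| ≤ 1) ∧
      ∀ x, ∃ U ∈ 𝒰, ∀ y, dist (Φ x) (Φ y) < 1 → y ∈ U := by
  obtain ⟨D, hD, h⟩ := h
  -- `f U` vanishes off `U`, and every `x` has some `U` with `f U x = 1`; a point at distance less
  -- than `1` then has `f U ≠ 0`.
  choose f hf hf01 hf1 hfD using fun U : 𝒰 =>
    exists_uniformContinuous_urysohn hD {x | UniformSpace.ball x D ⊆ U.1}
  refine ⟨fun x U => f U x, uniformContinuous_pi.2 hf, fun x U => ?_, fun x => ?_⟩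
  · rw [abs_of_nonneg (hf01 U x).1]
    exact (hf01 U x).2
  · obtain ⟨U, hU, hx⟩ := h x
    refine ⟨U, hU, fun y hy => ?_⟩
    have h1 := (dist_le_pi_dist _ _ (⟨U, hU⟩ : 𝒰)).trans_lt hy
    simp only at h1
    rw [hf1 ⟨U, hU⟩ x hx, Real.dist_eq] at h1
    obtain ⟨a, ha, hay⟩ := hfD ⟨U, hU⟩ y fun h0 => by simp [h0] at h1
    exact ha hay

open Set in
theorem exists_mem_uniformity_injOn {X : Type*} [UniformSpace X] [T2Space X] {S : Set X}
    (hS : S.Finite) : ∃ D ∈ 𝓤 X, ∀ p ∈ S, ∀ q ∈ S, (p, q) ∈ D → p = q := by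
  have hex : ∀ p : X × X, ∃ D ∈ 𝓤 X, p ∈ D → p.1 = p.2 := by
    rintro ⟨p, q⟩
    by_cases h : p = q
    · exact ⟨univ, Filter.univ_mem, fun _ => h⟩
    · by_contra! h'
      exact h (eq_of_uniformity fun {D} hD => (h' D hD).1)
  choose D hD h using hex
  refine ⟨⋂ p ∈ S ×ˢ S, D p, (Filter.biInter_mem (hS.prod hS)).2 fun p _ => hD p, ?_⟩
  intro p hp q hq hpq
  exact h (p, q) (mem_iInter₂.1 hpq (p, q) ⟨hp, hq⟩)

/-! ### Almost invariant families and their labelled coverings -/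

section Labelling

variable {X : Type*} [UniformSpace X]

theorem isOpen_setOf_forall_abs_sub_lt {K : Type*} [Finite K] (T : K → UCb X) (x : X) (δ : ℝ) :
    IsOpen {y | ∀ k, |(T k).1 y - (T k).1 x| < δ} := by
  rw [Set.ofPred_forall]
  exact isOpen_iInter_of_finite fun k =>
    isOpen_lt ((T k).2.1.continuous.sub continuous_const).abs continuous_const

open Finset in
/-- For an invariant mean, there are large finite families of points in general position which are
almost invariant: for every `g` in a finite set, the `g`-translates can be matched up to a small
number of exceptions with the original points, so that matched points are close with respect to a
given bounded uniformly continuous map. -/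
theorem exists_almost_invariant_points [Nonempty X] [T2Space X] [PerfectSpace X]
    {G : Subgroup (X ≃ᵤ X)} (hG : TopologicallyFree G) (hA : Amenable G) (E : Finset G)
    {κ : Type*} [Fintype κ] {Φ : X → κ → ℝ} (hΦ : UniformContinuous Φ)
    (hb : ∃ C, ∀ x k, |Φ x k| ≤ C) {r δ : ℝ} (hr : 0 < r) (hδ : 0 < δ) (N : ℕ) :
    ∃ n ≥ N, ∃ y : Fin n → X, (Function.Injective fun p : E × Fin n => (p.1.1 : X ≃ᵤ X) (y p.2)) ∧
      ∃ d : ℕ, (d : ℝ) ≤ δ * n ∧ ∃ ψ : E → Fin n → Fin n ⊕ Fin d, ∀ g, Function.Injective (ψ g) ∧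
        ∀ i j, ψ g j = Sum.inl i → dist (Φ ((g.1 : X ≃ᵤ X) (y j))) (Φ (y i)) < r := by
  classical
  obtain ⟨m, hm, hinv⟩ := hA
  obtain ⟨T, hT⟩ := exists_finset_forall_dist_lt hb (show 0 < r / 3 by positivity)
  -- One test function per subset `J` of the net `T` handles Hall's condition for every `A`, however
  -- large `n` is. The three errors of `r / 3` are: translate to net point, net point to witness,
  -- witness to `y i`.
  choose f hf hf01 hf1 hf0 using fun J : Finset (κ → ℝ) =>
    exists_uniformContinuous_urysohn (setOf_dist_lt_mem_uniformity hΦ (show 0 < r / 3 by positivity))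
      {x | ∃ t ∈ J, dist (Φ x) t < r / 3}
  let F : Finset (κ → ℝ) → UCb X := fun J =>
    ⟨f J, hf J, 1, fun x => abs_le.2 ⟨by linarith [(hf01 J x).1], (hf01 J x).2⟩⟩
  let R : E × T.powerset → UCb X := fun k => UCb.comp (F k.2.1) k.1.1 - F k.2.1
  obtain ⟨n, hn, x, hx⟩ := exists_fin_sum_le_of_isMean hm R
    (fun k => by rw [map_sub, ← hinv _ _ k.1.1.2, sub_self]) (half_pos hδ) N
  -- Half of `δ` is spent on approximating the mean, half on perturbing the points.
  obtain ⟨y, hy, hinj⟩ := hG.exists_injective E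
    (fun j => {z | ∀ k, |(R k).1 z - (R k).1 (x j)| < δ / 2})
    (fun j => isOpen_setOf_forall_abs_sub_lt R (x j) _)
    (fun j => ⟨x j, fun k => by simpa using half_pos hδ⟩)
  have hsum : ∀ k, |∑ j, (R k).1 (y j)| ≤ δ * n := by
    intro k
    have h1 : |∑ j, ((R k).1 (y j) - (R k).1 (x j))| ≤ n * (δ / 2) := by
      refine (abs_sum_le_sum_abs _ _).trans ?_
      refine (sum_le_card_nsmul _ _ (δ / 2) fun j _ => (hy j k).le).trans_eq (by simp)
    rw [sum_sub_distrib] at h1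
    have h2 := abs_add_le (∑ j, (R k).1 (y j) - ∑ j, (R k).1 (x j)) (∑ j, (R k).1 (x j))
    rw [sub_add_cancel] at h2
    linarith [hx k]
  refine ⟨n, hn, y, hinj, ⌊δ * n⌋₊, Nat.floor_le (by positivity), ?_⟩
  have hall : ∀ g : E, ∃ ψ : Fin n → Fin n ⊕ Fin ⌊δ * n⌋₊, Function.Injective ψ ∧
      ∀ j i, ψ j = Sum.inl i → dist (Φ ((g.1 : X ≃ᵤ X) (y j))) (Φ (y i)) < r := by
    intro g
    refine exists_injective_sum_fin_of_card_le
      (fun j i : Fin n => dist (Φ ((g.1 : X ≃ᵤ X) (y j))) (Φ (y i)) < r) _ fun A => ?_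
    set B : Finset (Fin n) := {i | ∃ j ∈ A, dist (Φ ((g.1 : X ≃ᵤ X) (y j))) (Φ (y i)) < r} with hB
    let J : Finset (κ → ℝ) := {t ∈ T | ∃ j ∈ A, dist (Φ ((g.1 : X ≃ᵤ X) (y j))) t < r / 3}
    have hJ : J ∈ T.powerset := mem_powerset.2 (filter_subset _ _)
    have hA : (#A : ℝ) ≤ ∑ j, f J ((g.1 : X ≃ᵤ X) (y j)) := by
      calc (#A : ℝ) = ∑ j ∈ A, f J ((g.1 : X ≃ᵤ X) (y j)) := by
            rw [sum_congr rfl fun j hj => hf1 J _ ?_]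
            · simp
            · obtain ⟨t, ht, hd⟩ := hT ((g.1 : X ≃ᵤ X) (y j))
              exact ⟨t, mem_filter.2 ⟨ht, j, hj, hd⟩, hd⟩
        _ ≤ _ := sum_le_sum_of_subset_of_nonneg (subset_univ _) fun j _ _ => (hf01 J _).1
    have hBs : ∑ i, f J (y i) ≤ #B := by
      calc ∑ i, f J (y i) = ∑ i ∈ B, f J (y i) := by
            refine (sum_subset (subset_univ _) fun i _ hi => ?_).symm
            by_contra h0
            obtain ⟨a, ⟨t, ht, hat⟩, hai⟩ := hf0 J (y i) h0
            obtain ⟨-, j, hj, hjt⟩ := mem_filter.1 ht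
            refine hi (mem_filter.2 ⟨mem_univ _, j, hj, ?_⟩)
            have h1 : dist (Φ a) (Φ (y i)) < r / 3 := hai
            have h2 := dist_triangle4 (Φ ((g.1 : X ≃ᵤ X) (y j))) t (Φ a) (Φ (y i))
            rw [dist_comm t (Φ a)] at h2
            exact h2.trans_lt ((add_lt_add (add_lt_add hjt hat) h1).trans_eq (by ring))
        _ ≤ ∑ i ∈ B, (1 : ℝ) := sum_le_sum fun i _ => (hf01 J _).2
        _ = #B := by simp
    have hR : ∑ j, f J ((g.1 : X ≃ᵤ X) (y j)) - ∑ j, f J (y j) ≤ δ * n := by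
      have h1 := (le_abs_self _).trans (hsum (g, ⟨J, hJ⟩))
      have h2 : ∀ z, (R (g, ⟨J, hJ⟩)).1 z = f J ((g.1 : X ≃ᵤ X) z) - f J z := fun z => rfl
      simp only [h2, sum_sub_distrib] at h1
      exact h1
    -- Hall's condition: `#A ≤ ∑ f J (g (y j)) ≤ ∑ f J (y j) + δ * n ≤ #B + δ * n`.
    suffices h : #A - #B ≤ ⌊δ * n⌋₊ by
      rw [Nat.sub_le_iff_le_add'] at h
      convert h
    refine Nat.le_floor ?_
    rcases le_total #B #A with hle | hle
    · rw [Nat.cast_sub hle]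
      linarith
    · rw [Nat.sub_eq_zero_of_le hle, Nat.cast_zero]
      positivity
  choose ψ hψ hψr using hall
  exact ⟨ψ, fun g => ⟨hψ g, fun i j => hψr g j i⟩⟩

end Labelling

open Set in
/-- Finitely many labelled points are separated from points with different labels by a finite
uniform covering with few small members, if points with equal labels are close. -/
theorem exists_finset_covering_of_labelling {X κ ι L : Type*} [UniformSpace X] [T2Space X]
    [Fintype κ] [Finite ι] [Fintype L] {Φ : X → κ → ℝ} (hΦ : UniformContinuous Φ)
    {T : Finset (κ → ℝ)} (hT : ∀ x, ∃ t ∈ T, dist (Φ x) t < 1 / 8) {z : ι → X}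
    (hz : Function.Injective z) {l : ι → L}
    (hl : ∀ p q, l p = l q → dist (Φ (z p)) (Φ (z q)) < 3 / 4) :
    ∃ 𝒲 : Finset (Set X), (𝒲 : Set (Set X)) ∈ finiteUniformCoverings X ∧
      𝒲.card ≤ Fintype.card L + T.card ∧
      (∀ w ∈ 𝒲, ∀ p ∈ w, ∀ q ∈ w, dist (Φ p) (Φ q) < 1) ∧
      ∀ w ∈ 𝒲, ∀ p q, z p ∈ w → z q ∈ w → l p = l q := by
  classical
  obtain ⟨D₁, hD₁, hS⟩ := exists_mem_uniformity_injOn (finite_range z)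
  have hD₂ := Filter.inter_mem hD₁
    (setOf_dist_lt_mem_uniformity hΦ (show (0 : ℝ) < 1 / 8 by norm_num))
  set D₂ := D₁ ∩ {p : X × X | dist (Φ p.1) (Φ p.2) < 1 / 8} with hD₂_def
  obtain ⟨D, hD, hDsymm, hDD⟩ := comp_symm_mem_uniformity_sets hD₂
  -- `W c` fattens a label class, and `D₁` keeps points with other labels out; `Z t` avoids all
  -- labelled points. The `D`-ball of `p` lies in some `W c` if it contains a labelled point, and in
  -- some `Z t` otherwise.
  let W : L → Set X := fun c => {p | ∃ q, l q = c ∧ (z q, p) ∈ D₂}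
  let Z : (κ → ℝ) → Set X := fun t => {p | dist (Φ p) t < 1 / 4 ∧ p ∉ range z}
  let 𝒲 : Finset (Set X) := Finset.univ.image W ∪ T.image Z
  have hmem𝒲 : ∀ w ∈ 𝒲, (∃ c, W c = w) ∨ ∃ t, Z t = w := by
    intro w hw
    rcases Finset.mem_union.1 hw with h | h
    · obtain ⟨c, -, h⟩ := Finset.mem_image.1 h
      exact Or.inl ⟨c, h⟩
    · obtain ⟨t, -, h⟩ := Finset.mem_image.1 h
      exact Or.inr ⟨t, h⟩
  have hcard : 𝒲.card ≤ Fintype.card L + T.card := by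
    refine (Finset.card_union_le _ _).trans (add_le_add ?_ Finset.card_image_le)
    exact Finset.card_image_le
  have h𝒲 : (𝒲 : Set (Set X)) ∈ finiteUniformCoverings X := by
    refine ⟨𝒲.finite_toSet, D, hD, fun p => ?_⟩
    by_cases hp : ∃ q, (p, z q) ∈ D
    · obtain ⟨q, hq⟩ := hp
      refine ⟨W (l q), Finset.mem_coe.2 (Finset.mem_union_left _
        (Finset.mem_image_of_mem _ (Finset.mem_univ _))), fun p' hp' => ⟨q, rfl, hDD ?_⟩⟩
      exact ⟨p, hDsymm.symm _ _ hq, hp'⟩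
    · obtain ⟨t, ht, hpt⟩ := hT p
      refine ⟨Z t, Finset.mem_coe.2 (Finset.mem_union_right _ (Finset.mem_image_of_mem _ ht)),
        fun p' hp' => ⟨?_, ?_⟩⟩
      · have h1 : (p, p') ∈ D₂ := hDD ⟨p, refl_mem_uniformity hD, hp'⟩
        have h2 : dist (Φ p) (Φ p') < 1 / 8 := h1.2
        have := dist_triangle_left (Φ p') t (Φ p)
        exact this.trans_lt ((add_lt_add h2 hpt).trans_eq (by norm_num))
      · rintro ⟨q, rfl⟩
        exact hp ⟨q, hp'⟩
  have hdist : ∀ w ∈ 𝒲, ∀ p ∈ w, ∀ q ∈ w, dist (Φ p) (Φ q) < 1 := by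
    intro w hw p hp q hq
    rcases hmem𝒲 w hw with ⟨c, rfl⟩ | ⟨t, rfl⟩
    · obtain ⟨a, ha, hap⟩ := hp
      obtain ⟨b, hb, hbq⟩ := hq
      have h1 : dist (Φ (z a)) (Φ p) < 1 / 8 := hap.2
      have h2 : dist (Φ (z b)) (Φ q) < 1 / 8 := hbq.2
      have h3 := hl a b (ha.trans hb.symm)
      have h4 := dist_triangle4 (Φ p) (Φ (z a)) (Φ (z b)) (Φ q)
      rw [dist_comm (Φ p) (Φ (z a))] at h4
      linarith
    · have h1 : dist (Φ p) t < 1 / 4 := hp.1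
      have h2 : dist (Φ q) t < 1 / 4 := hq.1
      have := dist_triangle_right (Φ p) (Φ q) t
      linarith
  refine ⟨𝒲, h𝒲, hcard, hdist, fun w hw p q hp hq => ?_⟩
  rcases hmem𝒲 w hw with ⟨c, rfl⟩ | ⟨t, rfl⟩
  · obtain ⟨a, ha, hap⟩ := hp
    obtain ⟨b, hb, hbq⟩ := hq
    have h1 := hz (hS _ (mem_range_self a) _ (mem_range_self p) hap.1)
    have h2 := hz (hS _ (mem_range_self b) _ (mem_range_self q) hbq.1)
    rw [← h1, ← h2, ha, hb]
  · exact absurd (mem_range_self _) hp.2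

/-! ### From an invariant mean to small growth -/

open Set in
theorem exists_refines_of_amenable {X : Type*} [UniformSpace X] [Nonempty X] [T2Space X]
    [PerfectSpace X] {G : Subgroup (X ≃ᵤ X)} (hG : TopologicallyFree G) (hA : Amenable G)
    {E : Finset G} (hE : 1 ∈ E) {𝒰 : Set (Set X)} (h𝒰 : 𝒰 ∈ finiteUniformCoverings X) {ε : ℝ}
    (hε : 0 < ε) : ∃ 𝒱 ∈ finiteUniformCoverings X, Refines 𝒱 𝒰 ∧
      (uniformComplexity (join fun g : E => imageCovering (g : X ≃ᵤ X) 𝒱) : ℝ) ≤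
        (1 + ε) * uniformComplexity 𝒱 := by
  classical
  have : Fintype 𝒰 := h𝒰.1.fintype
  obtain ⟨Φ₀, hΦ₀, hb₀, hΦ₀U⟩ := exists_uniformContinuous_forall_exists_subset h𝒰.2
  -- Recording `Φ₀ ∘ g⁻¹` for all `g ∈ E` makes `g⁻¹(W)` small for `𝒰`, simultaneously in `g`,
  -- whenever `W` is small for `Φ`.
  let Φ : X → E × 𝒰 → ℝ := fun x k => Φ₀ ((k.1.1 : X ≃ᵤ X).symm x) k.2
  have hΦ : UniformContinuous Φ := uniformContinuous_pi.2 fun k =>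
    (uniformContinuous_pi.1 hΦ₀ k.2).comp (k.1.1 : X ≃ᵤ X).symm.uniformContinuous
  have hb : ∃ C, ∀ x k, |Φ x k| ≤ C := ⟨1, fun x k => hb₀ _ _⟩
  have hsmall : ∀ W : Set X, (∀ p ∈ W, ∀ q ∈ W, dist (Φ p) (Φ q) < 1) → ∀ g : E,
      ∃ U ∈ 𝒰, (g.1 : X ≃ᵤ X) ⁻¹' W ⊆ U := by
    intro W hW g
    rcases ((g.1 : X ≃ᵤ X) ⁻¹' W).eq_empty_or_nonempty with h | ⟨p, hp⟩
    · obtain ⟨U, hU, -⟩ := exists_mem_of_isUniformCovering h𝒰.2 (Classical.arbitrary X)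
      exact ⟨U, hU, h ▸ empty_subset U⟩
    · obtain ⟨U, hU, hpU⟩ := hΦ₀U p
      refine ⟨U, hU, fun q hq => hpU q ?_⟩
      refine ((dist_pi_le_iff dist_nonneg).2 fun V => ?_).trans_lt (hW _ hp _ hq)
      have := dist_le_pi_dist (Φ ((g.1 : X ≃ᵤ X) p)) (Φ ((g.1 : X ≃ᵤ X) q)) (g, V)
      simpa [Φ] using this
  obtain ⟨T, hT⟩ := exists_finset_forall_dist_lt hb (show (0 : ℝ) < 1 / 8 by norm_num)
  -- The two error terms in `#𝒲 ≤ n + #E * d + #T` get `ε / 2 * n` each: `N` controls `#T`, and `δ`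
  -- controls `#E * d`.
  obtain ⟨N, hN⟩ := exists_nat_ge (2 * T.card / ε)
  obtain ⟨δ, hδ, hEδ⟩ : ∃ δ : ℝ, 0 < δ ∧ (E.card + 1) * δ = ε / 2 :=
    ⟨ε / (2 * (E.card + 1)), by positivity, by field_simp⟩
  obtain ⟨n, hn, y, hinj, d, h4, ψ, hψ⟩ := exists_almost_invariant_points hG hA E hΦ hb
    (show (0 : ℝ) < 3 / 8 by norm_num) hδ N
  let z : E × Fin n → X := fun p => (p.1.1 : X ≃ᵤ X) (y p.2)
  -- A matched translate takes the index of its partner, an unmatched one a label private to `g`.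
  -- Labels are thus injective for fixed `g`, and equal labels mean closeness within `3 / 8 + 3 /
  -- 8`.
  let l : E × Fin n → Fin n ⊕ E × Fin d := fun p => Sum.map id (fun t => (p.1, t)) (ψ p.1 p.2)
  have hl : ∀ g j j', l (g, j) = l (g, j') → j = j' := by
    intro g j j' h
    refine (hψ g).1 (Sum.map_injective.2 ⟨Function.injective_id, fun a b hab => ?_⟩ h)
    exact (Prod.ext_iff.1 hab).2
  have hlz : ∀ p q, l p = l q → dist (Φ (z p)) (Φ (z q)) < 3 / 4 := by
    rintro ⟨g, j⟩ ⟨h, j'⟩ e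
    rcases hj : ψ g j with i | t <;> rcases hj' : ψ h j' with i' | t' <;>
      simp only [l, hj, hj', Sum.map_inl, Sum.map_inr, id, Sum.inl.injEq, Sum.inr.injEq,
        reduceCtorEq, Prod.mk.injEq] at e
    · subst e
      have h1 := (hψ g).2 i j hj
      have h2 := (hψ h).2 i j' hj'
      have := dist_triangle_right (Φ (z (g, j))) (Φ (z (h, j'))) (Φ (y i))
      refine this.trans_lt ((add_lt_add h1 h2).trans_eq (by norm_num))
    · obtain ⟨rfl, rfl⟩ := e
      rw [(hψ g).1 (hj.trans hj'.symm), dist_self]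
      norm_num
  obtain ⟨𝒲, h𝒲, hcard, hdist, hsep⟩ := exists_finset_covering_of_labelling hΦ hT hinj hlz
  have hLcard : Fintype.card (Fin n ⊕ E × Fin d) = n + E.card * d := by simp
  rw [hLcard] at hcard
  let 𝒱 : Set (Set X) := ⋃ g : E, (fun w => (g.1 : X ≃ᵤ X) ⁻¹' w) '' (𝒲 : Set (Set X))
  have h𝒱 : 𝒱 ∈ finiteUniformCoverings X := by
    refine ⟨finite_iUnion fun g => 𝒲.finite_toSet.image _, ?_⟩
    obtain ⟨-, D', hD', h⟩ := h𝒲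
    refine ⟨D', hD', fun p => ?_⟩
    obtain ⟨w, hw, hpw⟩ := h p
    exact ⟨w, mem_iUnion.2 ⟨⟨1, hE⟩, w, hw, rfl⟩, hpw⟩
  refine ⟨𝒱, h𝒱, ?_, ?_⟩
  · intro V hV
    obtain ⟨g, w, hw, rfl⟩ := mem_iUnion.1 hV
    exact hsmall w (hdist w hw) g
  have h1 : uniformComplexity (join fun g : E => imageCovering (g : X ≃ᵤ X) 𝒱) ≤ 𝒲.card := by
    rw [← Set.ncard_coe_finset]
    refine uniformComplexity_le_ncard h𝒲 fun w hw => ?_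
    refine ⟨_, ⟨fun _ => w, fun g => ⟨(g.1 : X ≃ᵤ X) ⁻¹' w, mem_iUnion.2 ⟨g, w, hw, rfl⟩, ?_⟩, rfl⟩,
      subset_iInter fun _ => subset_rfl⟩
    exact image_preimage_eq _ (g.1 : X ≃ᵤ X).surjective
  -- If `y j` and `y j'` lie in `g⁻¹(w)`, their `g`-translates lie in `w` and share a label, so `j =
  -- j'`.
  have h2 : n ≤ uniformComplexity 𝒱 := by
    obtain ⟨𝒱', h𝒱', hr, hc⟩ := exists_refines_ncard_eq_uniformComplexity h𝒱
    choose v hv hyv using fun j => exists_mem_of_isUniformCovering h𝒱'.2 (y j)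
    have hvinj : Function.Injective v := by
      intro j j' e
      obtain ⟨V, hV, hvV⟩ := hr (v j) (hv j)
      obtain ⟨g, w, hw, rfl⟩ := mem_iUnion.1 hV
      exact hl g j j' (hsep w hw (g, j) (g, j') (hvV (hyv j)) (hvV (e ▸ hyv j')))
    rw [← hc]
    have := ncard_le_ncard (range_subset_iff.2 hv) h𝒱'.1
    rwa [← image_univ, ncard_image_of_injective _ hvinj, ncard_univ, Nat.card_eq_fintype_card,
      Fintype.card_fin] at this
  have h3 : (uniformComplexity (join fun g : E => imageCovering (g : X ≃ᵤ X) 𝒱) : ℝ) ≤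
      n + E.card * d + T.card := by
    exact_mod_cast h1.trans hcard
  have h5 : (E.card : ℝ) * d ≤ ε / 2 * n := by
    calc (E.card : ℝ) * d ≤ (E.card + 1) * (δ * n) := by gcongr; linarith
      _ = ε / 2 * n := by rw [← mul_assoc, hEδ]
  have h6 : (T.card : ℝ) ≤ ε / 2 * n := by
    have : (N : ℝ) ≤ n := by exact_mod_cast hn
    have := (div_le_iff₀ hε).1 (hN.trans this)
    linarith
  calc _ ≤ (1 + ε) * n := by linarith
    _ ≤ _ := by gcongr

end UniformDynamics

/-! ### The equivalence -/

open UniformDynamics in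
theorem theorem7p2 {X : Type*} [UniformSpace X] [Nonempty X] [T2Space X] [PerfectSpace X]
    (G : Subgroup (X ≃ᵤ X)) (hG : TopologicallyFree G) :
    Amenable G ↔
      (⨆ E : Finset G, ⨆ 𝒰 ∈ finiteUniformCoverings X,
        ⨅ 𝒱 ∈ {𝒱 ∈ finiteUniformCoverings X | Refines 𝒱 𝒰},
          (uniformComplexity (join fun g : E => imageCovering (g : X ≃ᵤ X) 𝒱) : ℝ≥0∞) /
            (uniformComplexity 𝒱 : ℝ≥0∞)) = 1 := by
  classical
  have hjoin : ∀ (E : Finset G), ∀ 𝒱 ∈ finiteUniformCoverings X,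
      join (fun g : E => imageCovering (g : X ≃ᵤ X) 𝒱) ∈ finiteUniformCoverings X :=
    fun E 𝒱 h => join_mem_finiteUniformCoverings fun g =>
      imageCovering_mem_finiteUniformCoverings _ h
  constructor
  · intro hA
    refine le_antisymm (iSup_le fun E => iSup₂_le fun 𝒰 h𝒰 => ?_) ?_
    · refine ENNReal.le_of_forall_pos_le_add fun ε hε _ => ?_
      -- Enlarging `E` by `1` is harmless, since it only refines the join.
      obtain ⟨𝒱, h𝒱, hr, hN⟩ := exists_refines_of_amenable hG hA (Finset.mem_insert_self 1 E) h𝒰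
        (NNReal.coe_pos.2 hε)
      refine (iInf₂_le 𝒱 ⟨h𝒱, hr⟩).trans (ENNReal.div_le_of_le_mul ?_)
      have hmono : uniformComplexity (join fun g : E => imageCovering (g : X ≃ᵤ X) 𝒱) ≤
          uniformComplexity
            (join fun g : (insert 1 E : Finset G) => imageCovering (g : X ≃ᵤ X) 𝒱) := by
        refine uniformComplexity_mono (hjoin _ 𝒱 h𝒱) ?_
        rintro _ ⟨U, hU, rfl⟩
        refine ⟨_, ⟨fun g : E => U ⟨g.1, Finset.mem_insert_of_mem g.2⟩, fun g => hU ⟨g.1, Finset.mem_insert_of_mem g.2⟩, rfl⟩, ?_⟩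
        exact Set.subset_iInter fun g => Set.iInter_subset _ _
      have h1 : (uniformComplexity (join fun g : E => imageCovering (g : X ≃ᵤ X) 𝒱) : NNReal) ≤
          (1 + ε) * uniformComplexity 𝒱 := by
        rw [← NNReal.coe_le_coe]
        push_cast
        exact le_trans (by exact_mod_cast hmono) hN
      exact_mod_cast h1
    · have huniv : ({Set.univ} : Set (Set X)) ∈ finiteUniformCoverings X :=
        ⟨Set.finite_singleton _, Set.univ, Filter.univ_mem,
          fun x => ⟨Set.univ, rfl, Set.subset_univ _⟩⟩
      -- For `E = {1}` the join refines `𝒱`, so every ratio is at least `1`.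
      refine le_trans ?_ (le_iSup_of_le {1} (le_iSup₂_of_le {Set.univ} huniv le_rfl))
      refine le_iInf₂ fun 𝒱 h𝒱 => ?_
      have hpos : uniformComplexity 𝒱 ≠ 0 := (uniformComplexity_pos h𝒱.1).ne'
      rw [ENNReal.le_div_iff_mul_le (Or.inl (by exact_mod_cast hpos))
        (Or.inl (ENNReal.natCast_ne_top _)), one_mul, Nat.cast_le]
      refine uniformComplexity_mono (hjoin _ 𝒱 h𝒱.1) ?_
      rintro _ ⟨U, hU, rfl⟩
      obtain ⟨V, hV, hVU⟩ := hU ⟨1, Finset.mem_singleton_self 1⟩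
      refine ⟨V, hV, (Set.iInter_subset _ ⟨1, Finset.mem_singleton_self 1⟩).trans ?_⟩
      rw [← hVU]
      rintro _ ⟨x, hx, rfl⟩
      exact hx
  · intro h
    refine amenable_of_forall_exists_refines fun E 𝒰 h𝒰 ε hε => ?_
    have h1 : (⨅ 𝒱 ∈ {𝒱 ∈ finiteUniformCoverings X | Refines 𝒱 𝒰},
          (uniformComplexity (join fun g : E => imageCovering (g : X ≃ᵤ X) 𝒱) : ℝ≥0∞) /
            (uniformComplexity 𝒱 : ℝ≥0∞)) < 1 + ENNReal.ofReal ε := by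
      refine lt_of_le_of_lt
        (iSup₂_le_iff.1 (iSup_le_iff.1 h.le E) 𝒰 h𝒰) ?_
      exact ENNReal.lt_add_right ENNReal.one_ne_top (ENNReal.ofReal_pos.2 hε).ne'
    simp only [iInf_lt_iff] at h1
    obtain ⟨𝒱, ⟨h𝒱, hr⟩, hlt⟩ := h1
    refine ⟨𝒱, h𝒱, hr, ?_⟩
    have hpos : uniformComplexity 𝒱 ≠ 0 := (uniformComplexity_pos h𝒱).ne'
    rw [ENNReal.div_lt_iff (Or.inl (by exact_mod_cast hpos))
      (Or.inl (ENNReal.natCast_ne_top _))] at hlt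
    have h2 := ENNReal.toReal_mono (by finiteness) hlt.le
    simpa [ENNReal.toReal_add, hε.le] using h2
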